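/- Let $M\cong\mathbb{Z}^d$ be a lattice, $\sigma\subseteq M_{\mathbb{R}}=\mathbb{R}\otimes M$ a rational convex polyhedral cone, $S=\sigma\cap M$, $k$ a field of characteristic $p>0$, and $R=k[S]$. Let $e\ge 1$, and let $\kappa:k\to k$ be an additive map with $\kappa(1)=1$ and $\kappa(a^{p^e}b)=a\,\kappa(b)$ for all $a,b\in k$ (if $k$ is perfect, necessarily $\kappa(a)=a^{1/p^e}$). Let $\phi_c:k[M]\to k[M]$ be the canonical splitting: the additive map with $\phi_c(c\,x^m)=\kappa(c)\,x^{m/p^e}$ if $m/p^e\in M$, and $\phi_c(c\,x^m)=0$ otherwise. Let $\phi:R\to R$ be a toric map, that is, $\phi(f)=\phi_c(x^{-w}f)$ for all $f\in R$, for some $w\in M$ such that $\phi_c(x^{-w}R)\subseteq R$. Let $\mathfrak{a}\subseteq R$ be a monomial ideal and let $t\ge 0$ be a rational number whose denominator in lowest terms is not divisible by $p$. Call an ideal $I\subseteq R$ fixed if \[ \sum_{n}\phi^n\left(\overline{\mathfrak{a}^{t(p^{en}-1)}}\cdot I\right)=I, \] where the sum runs over all integers $n>0$ such that $t(p^{en}-1)$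 is an integer, $\phi^n$ is the $n$-th iterate of $\phi$, $\overline{J}$ denotes the integral closure of the ideal $J$, and $J^0=R$ for every ideal $J$. Then the set of fixed ideals is closed under intersection: the intersection of any nonempty family of fixed ideals (in particular, of any two) is fixed. No surjectivity of $\phi$ is assumed. -/

import Mathlib

noncomputable section

open scoped TensorProduct

namespace ToricFixed

/-! ### Integral closure of an ideal -/

section IntegralClosure

variable {R : Type*} [CommRing R]

/-- `r` is integral over the ideal `J`: it satisfies an equation
`r ^ n + a 1 * r ^ (n - 1) + ⋯ + a n = 0` with `a i ∈ J ^ i` for all `1 ≤ i ≤ n`. -/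
def IsIntegralOverIdeal (J : Ideal R) (r : R) : Prop :=
  ∃ (n : ℕ) (a : ℕ → R), (∀ i ∈ Finset.Icc 1 n, a i ∈ J ^ i) ∧
    r ^ n + ∑ i ∈ Finset.Icc 1 n, a i * r ^ (n - i) = 0

/-- Being integral over `J` amounts to `r T` being integral over the Rees algebra of `J`. -/
theorem isIntegralOverIdeal_iff (J : Ideal R) (r : R) :
    IsIntegralOverIdeal J r ↔ IsIntegral (reesAlgebra J) (Polynomial.monomial 1 r) := by
  constructor
  · rintro ⟨n, a, ha, h⟩
    classical
    let c : ℕ → reesAlgebra J := fun i =>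
      if hi : a i ∈ J ^ i then ⟨Polynomial.monomial i (a i), reesAlgebra.monomial_mem.mpr hi⟩
      else 0
    have hc : ∀ i ∈ Finset.Icc 1 n,
        ((c i : reesAlgebra J) : Polynomial R) = Polynomial.monomial i (a i) := by
      intro i hi
      simp only [c, dif_pos (ha i hi)]
    by_cases hR : Subsingleton R
    · exact ⟨1, Polynomial.monic_one, Subsingleton.elim _ _⟩
    have : Nontrivial R := not_subsingleton_iff_nontrivial.mp hR
    refine ⟨Polynomial.X ^ n + ∑ i ∈ Finset.Icc 1 n, Polynomial.C (c i) * Polynomial.X ^ (n - i),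
      ?_, ?_⟩
    · apply Polynomial.monic_X_pow_add
      refine Polynomial.mem_degreeLT.mp (Submodule.sum_mem _ fun i hi => ?_)
      rw [Finset.mem_Icc] at hi
      rw [Polynomial.mem_degreeLT]
      refine (Polynomial.degree_C_mul_X_pow_le _ _).trans_lt ?_
      exact_mod_cast (by omega : n - i < n)
    · rw [Polynomial.eval₂_add, Polynomial.eval₂_finsetSum, Polynomial.eval₂_X_pow]
      have h2 : ∀ i ∈ Finset.Icc 1 n,
          Polynomial.eval₂ (algebraMap (reesAlgebra J) (Polynomial R)) (Polynomial.monomial 1 r)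
            (Polynomial.C (c i) * Polynomial.X ^ (n - i)) =
          Polynomial.monomial n (a i * r ^ (n - i)) := by
        intro i hi
        have h3 := hc i hi
        rw [Finset.mem_Icc] at hi
        rw [Polynomial.eval₂_mul, Polynomial.eval₂_C, Polynomial.eval₂_X_pow]
        change ((c i : reesAlgebra J) : Polynomial R) * _ = _
        rw [h3, Polynomial.monomial_pow, Polynomial.monomial_mul_monomial,
          show i + 1 * (n - i) = n by omega]
      rw [Finset.sum_congr rfl h2, Polynomial.monomial_pow, one_mul, ← map_sum, ← map_add, h,
        map_zero]
  · rintro ⟨P, hP, h⟩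
    have key := congrArg (fun Q => Polynomial.coeff Q P.natDegree) h
    simp only [Polynomial.eval₂_eq_sum_range, Polynomial.finsetSum_coeff,
      Polynomial.coeff_zero] at key
    have hterm : ∀ j ∈ Finset.range (P.natDegree + 1),
        ((algebraMap (reesAlgebra J) (Polynomial R) (P.coeff j)) *
          (Polynomial.monomial 1 r) ^ j).coeff P.natDegree =
        ((P.coeff j : reesAlgebra J) : Polynomial R).coeff (P.natDegree - j) * r ^ j := by
      intro j hj
      rw [Finset.mem_range] at hj
      have : P.natDegree = (P.natDegree - j) + j := by omega
      rw [Polynomial.monomial_pow, one_mul]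
      conv_lhs => rw [this]
      rw [Polynomial.coeff_mul_monomial]
      rfl
    rw [Finset.sum_congr rfl hterm, Finset.sum_range_succ] at key
    refine ⟨P.natDegree,
      fun i => ((P.coeff (P.natDegree - i) : reesAlgebra J) : Polynomial R).coeff i, ?_, ?_⟩
    · intro i _
      exact (P.coeff (P.natDegree - i)).2 i
    · have hlead : P.coeff P.natDegree = 1 := hP
      rw [hlead] at key
      simp only [Nat.sub_self, OneMemClass.coe_one, Polynomial.coeff_one_zero, one_mul] at key
      rw [add_comm, ← key]
      congr 1
      refine Finset.sum_bij' (fun i _ => P.natDegree - i) (fun j _ => P.natDegree - j) ?_ ?_ ?_ ?_ ?_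
      · intro i hi
        simp only [Finset.mem_Icc, Finset.mem_range] at *
        omega
      · intro i hi
        simp only [Finset.mem_Icc, Finset.mem_range] at *
        omega
      · intro i hi
        simp only [Finset.mem_Icc] at *
        omega
      · intro i hi
        simp only [Finset.mem_range] at *
        omega
      · intro i hi
        simp only [Finset.mem_Icc] at hi
        have : P.natDegree - (P.natDegree - i) = i := by omega
        rw [this]

/-- The integral closure of the ideal `J` of `R`. -/
def idealClosure (J : Ideal R) : Ideal R where
  carrier := {r | IsIntegralOverIdeal J r}
  zero_mem' := ⟨1, fun _ => 0, by simp, by simp⟩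
  add_mem' := by
    intro x y hx hy
    simp only [Set.mem_ofPred_eq, isIntegralOverIdeal_iff, map_add] at *
    exact hx.add hy
  smul_mem' := by
    intro c x hx
    simp only [Set.mem_ofPred_eq, isIntegralOverIdeal_iff] at *
    have h : Polynomial.monomial 1 (c • x) = Polynomial.C c * Polynomial.monomial 1 x := by
      rw [Polynomial.C_mul_monomial, smul_eq_mul]
    rw [h]
    exact (isIntegral_algebraMap (x := algebraMap R (reesAlgebra J) c)).mul hx

end IntegralClosure

/-! ### Sums of images under the powers of an additive endomorphism -/

section Cartier

variable {R : Type*} [CommRing R]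

/-- The sum of the additive subgroups `φ ^ n (idealClosure (𝔞 ^ N) * I)`, where `φ ^ n` is the
`n`-fold iterate, over all `n > 0` for which `N = t (p ^ (e n) - 1)` is a (nonnegative) integer.
By convention `𝔞 ^ 0 = R`. -/
def cartierSum (p e : ℕ) (φ : AddMonoid.End R) (𝔞 : Ideal R) (t : ℚ) (I : Ideal R) :
    AddSubgroup R :=
  ⨆ (n : ℕ) (N : ℕ) (_ : 0 < n ∧ (N : ℚ) = t * ((p : ℚ) ^ (e * n) - 1)),
    AddSubgroup.map (φ ^ n : AddMonoid.End R)
      (Submodule.toAddSubgroup (idealClosure (𝔞 ^ N) * I))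

/-- The ideal `I` is fixed by the Cartier algebra generated by `φ` and `𝔞 ^ t`. -/
def IsCartierFixed (p e : ℕ) (φ : AddMonoid.End R) (𝔞 : Ideal R) (t : ℚ) (I : Ideal R) : Prop :=
  cartierSum p e φ 𝔞 t I = Submodule.toAddSubgroup I

end Cartier

/-! ### Affine toric rings -/

section Toric

variable {M : Type*} [AddCommGroup M]

/-- A rational convex polyhedral cone in `M_ℝ = ℝ ⊗ M`: one that is generated by finitely many
elements of `M`. -/
def IsRationalPolyhedral (σ : PointedCone ℝ (ℝ ⊗[ℤ] M)) : Prop :=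
  ∃ T : Finset M, σ = PointedCone.hull ℝ ((fun m : M => (1 : ℝ) ⊗ₜ[ℤ] m) '' (T : Set M))

/-- The monoid `S = σ ∩ M` of lattice points of a cone `σ`. -/
def latticePoints (σ : PointedCone ℝ (ℝ ⊗[ℤ] M)) : AddSubmonoid M where
  carrier := {m | (1 : ℝ) ⊗ₜ[ℤ] m ∈ σ}
  zero_mem' := by simp
  add_mem' := by
    intro a b ha hb
    simp only [Set.mem_ofPred_eq, TensorProduct.tmul_add] at *
    exact σ.add_mem ha hb

variable {k : Type*} [Field k]

/-- The inclusion of the toric ring `k[S]` into the ring `k[M]` of Laurent polynomials. -/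
def toLaurent (S : AddSubmonoid M) : AddMonoidAlgebra k S →+* AddMonoidAlgebra k M :=
  AddMonoidAlgebra.mapDomainRingHom k S.subtype

/-- An ideal of `k[S]` is monomial if it is generated by monomials `x ^ s`, `s ∈ S`. -/
def IsMonomialIdeal {S : AddSubmonoid M} (𝔞 : Ideal (AddMonoidAlgebra k S)) : Prop :=
  ∃ A : Set S, 𝔞 = Ideal.span ((fun s : S => AddMonoidAlgebra.single s (1 : k)) '' A)

/-- `κ` is a splitting of the Frobenius `a ↦ a ^ q` of the field `k`, where `q = p ^ e`.
If `k` is perfect, then the only such `κ` is `a ↦ a ^ (1 / q)`. -/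
def IsFrobeniusSplitting (q : ℕ) (κ : k →+ k) : Prop :=
  κ 1 = 1 ∧ ∀ a b : k, κ (a ^ q * b) = a * κ b

open scoped Classical in
/-- The canonical splitting on Laurent polynomials: it is additive and sends `c x ^ m` to
`κ(c) x ^ (m / q)` if `m / q ∈ M`, and to `0` otherwise. -/
def canonicalSplitting (q : ℕ) (κ : k →+ k) : AddMonoidAlgebra k M →+ AddMonoidAlgebra k M :=
  (Finsupp.liftAddHom fun m : M =>
    if h : ∃ m' : M, m = q • m' then (AddMonoidAlgebra.singleAddHom h.choose).comp κ else 0).comp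
    AddMonoidAlgebra.coeffAddEquiv.toAddMonoidHom

/-- `φ` is the toric map `φ(_) = φ_c(x ^ (-w) * _)` on `k[S]`. Such a `φ` exists exactly when
the right-hand side maps `k[S]` to itself, and it is then unique. -/
def IsToricMap (q : ℕ) (κ : k →+ k) {S : AddSubmonoid M} (w : M)
    (φ : AddMonoid.End (AddMonoidAlgebra k S)) : Prop :=
  ∀ f : AddMonoidAlgebra k S,
    toLaurent S (φ f) =
      canonicalSplitting q κ (AddMonoidAlgebra.single (-w) (1 : k) * toLaurent S f)

end Toric

end ToricFixed

end

open scoped TensorProduct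

namespace ToricFixed

/-! ### Farkas' lemma over the integers and lattice points of rational cones -/

section Farkas

/-! Write q = p^e. The sum in the definition is monotone in I, so only "⊇" needs work: each term c
x^s of an f in the intersection must be recovered from f itself. Let α be a weight that is
nonnegative on S and at least μ on 𝔞, and put X(s) = (q-1)α(s) + α(w) - (q-1)tμ. If s occurs in φ^n
of an element of the closure of 𝔞^N times I, then some z occurring in I has X(z) ≤ q^n X(s). As X is
bounded below on S, iterating gives X ≥ 0 on a fixed ideal (`IsCartierFixed.weight_nonneg`). With N
= t(q^n-1) and u = (q^n-1)s + (1+⋯+q^(n-1))w, this says α(u) ≥ Nμ for all such α and μ, so by Farkas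
x^u is integral over 𝔞^N (`single_mem_idealClosure_of_weight`). For large n, φ^n(c^(q^n-1) x^u f) =
c x^s, since no other exponent of f is congruent to s modulo q^n
(`IsToricMap.pow_single_mul_eq_single`). Neither surjectivity of φ nor monomiality of the fixed
ideals enters. -/

theorem exists_addMonoidHom_neg {L : Type*} [AddCommGroup L] [Module.Free ℤ L] {x : L}
    (hx : x ≠ 0) : ∃ ℓ : L →+ ℤ, ℓ x < 0 := by
  let b := Module.Free.chooseBasis ℤ L
  obtain ⟨i, hi⟩ : ∃ i, b.repr x i ≠ 0 := by
    by_contra! h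
    exact hx (b.repr.map_eq_zero_iff.mp (Finsupp.ext h))
  rcases lt_or_gt_of_ne hi with h | h
  · exact ⟨(b.coord i).toAddMonoidHom, by simpa using h⟩
  · exact ⟨-(b.coord i).toAddMonoidHom, by simpa using h⟩

/-- Farkas' lemma over `ℤ`. -/
theorem farkas_int {L ι : Type*} [AddCommGroup L] [Module.Free ℤ L] (s : Finset ι) :
    ∀ (g : ι → L) (x : L),
      (∃ K : ℕ, 0 < K ∧ ∃ c : ι → ℕ, K • x = ∑ i ∈ s, c i • g i) ∨
      ∃ ℓ : L →+ ℤ, (∀ i ∈ s, 0 ≤ ℓ (g i)) ∧ ℓ x < 0 := by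
  classical
  induction s using Finset.induction_on with
  | empty =>
    intro g x
    by_cases hx : x = 0
    · exact Or.inl ⟨1, one_pos, 0, by simp [hx]⟩
    · obtain ⟨ℓ, hℓ⟩ := exists_addMonoidHom_neg hx
      exact Or.inr ⟨ℓ, by simp, hℓ⟩
  | insert a s ha ih =>
    intro g x
    rcases ih g x with ⟨K, hK, c, h⟩ | ⟨ℓ, hℓ, hx⟩
    · refine Or.inl ⟨K, hK, Function.update c a 0, ?_⟩
      rw [Finset.sum_insert ha, Function.update_self, zero_smul, zero_add, h]
      refine Finset.sum_congr rfl fun i hi => ?_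
      rw [Function.update_of_ne (ne_of_mem_of_not_mem hi ha)]
    by_cases hga : 0 ≤ ℓ (g a)
    · exact Or.inr ⟨ℓ, by simpa [hga] using hℓ, hx⟩
    push Not at hga
    -- Projects to the kernel of ℓ and kills g a, so the induction hypothesis applies to the
    -- remaining generators.
    let π : L →+ L :=
      AddMonoidHom.mk' (fun y => ℓ y • g a - ℓ (g a) • y) fun y z => by
        simp only [map_add, add_smul, smul_add]; abel
    have hπ : ∀ y, π y = ℓ y • g a - ℓ (g a) • y := fun _ => rfl
    rcases ih (fun i => π (g i)) (π x) with ⟨K, hK, c, h⟩ | ⟨ℓ', hℓ', hx'⟩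
    -- Solve K π(x) = Σ cᵢ π(gᵢ) for x; the coefficient of g a is nonnegative because ℓ(gᵢ) ≥ 0 and
    -- ℓ(x) < 0.
    · refine Or.inl ⟨K * (-ℓ (g a)).toNat, Nat.mul_pos hK (by omega),
        Function.update (fun i => c i * (-ℓ (g a)).toNat) a
          ((∑ i ∈ s, c i * ℓ (g i)) - K * ℓ x).toNat, ?_⟩
      rw [Finset.sum_insert ha, Function.update_self]
      have h1 : ∑ i ∈ s, Function.update (fun i => c i * (-ℓ (g a)).toNat) a
          ((∑ i ∈ s, c i * ℓ (g i)) - K * ℓ x).toNat i • g i =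
          ∑ i ∈ s, (c i * (-ℓ (g a)).toNat) • g i := by
        refine Finset.sum_congr rfl fun i hi => ?_
        rw [Function.update_of_ne (ne_of_mem_of_not_mem hi ha)]
      have h2 : 0 ≤ (∑ i ∈ s, c i * ℓ (g i)) - K * ℓ x := by
        have h3 : 0 ≤ ∑ i ∈ s, (c i : ℤ) * ℓ (g i) :=
          Finset.sum_nonneg fun i hi => mul_nonneg (by positivity) (hℓ i hi)
        have h4 : (K : ℤ) * ℓ x ≤ 0 := mul_nonpos_of_nonneg_of_nonpos (by positivity) hx.le
        linarith
      have h5 : ((-ℓ (g a)).toNat : ℤ) = -ℓ (g a) := Int.toNat_of_nonneg (by omega)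
      rw [h1]
      simp only [← natCast_zsmul, Int.toNat_of_nonneg h2, Nat.cast_mul, h5, hπ] at h ⊢
      simp only [smul_sub, Finset.sum_sub_distrib, smul_smul, ← Finset.sum_smul] at h
      simp only [sub_smul, mul_neg, neg_smul, Finset.sum_neg_distrib]
      rw [sub_eq_sub_iff_add_eq_add] at h
      rw [← sub_eq_zero] at h ⊢
      rw [← h]
      abel
    · refine Or.inr ⟨ℓ'.comp π, ?_, hx'⟩
      intro i hi
      rcases Finset.mem_insert.mp hi with rfl | hi
      · simp [hπ]
      · exact hℓ' i hi

end Farkas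

/-! ### Lattice points of rational cones and Gordan's lemma. -/

section LatticePoints

variable {M : Type*} [AddCommGroup M]

/-- An integral functional extends ℝ-linearly to ℝ ⊗ M, so it can be tested on the real cone. -/
theorem nonneg_of_tmul_mem_hull (T : Finset M) (ℓ : M →+ ℤ) (hℓ : ∀ m ∈ T, 0 ≤ ℓ m) {m : M}
    (hm : (1 : ℝ) ⊗ₜ[ℤ] m ∈
      PointedCone.hull ℝ ((fun m : M => (1 : ℝ) ⊗ₜ[ℤ] m) '' (T : Set M))) : 0 ≤ ℓ m := by
  let L : ℝ ⊗[ℤ] M →ₗ[ℝ] ℝ :=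
    (TensorProduct.AlgebraTensorModule.rid ℤ ℝ ℝ).toLinearMap ∘ₗ
      ℓ.toIntLinearMap.baseChange ℝ
  have hL : ∀ y : M, L ((1 : ℝ) ⊗ₜ[ℤ] y) = ℓ y := fun y => by simp [L]
  have key : ∀ z ∈ PointedCone.hull ℝ ((fun m : M => (1 : ℝ) ⊗ₜ[ℤ] m) '' (T : Set M)),
      0 ≤ L z := by
    intro z hz
    induction hz using Submodule.span_induction with
    | mem x hx =>
      obtain ⟨y, hy, rfl⟩ := hx
      simpa [hL] using hℓ y hy
    | zero => simp
    | add x y _ _ hx hy => rw [map_add]; exact add_nonneg hx hy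
    | smul a x _ hx =>
      have : L (a • x) = (a : ℝ) * L x := L.map_smul (a : ℝ) x
      rw [this]
      exact mul_nonneg a.2 hx
  have := key _ hm
  rw [hL] at this
  exact_mod_cast this

/-- The lattice points of a rational polyhedral cone form the saturation of the monoid that is
generated by its generators. -/
theorem mem_latticePoints_hull_iff [Module.Free ℤ M] (T : Finset M) (m : M) :
    m ∈ latticePoints (PointedCone.hull ℝ ((fun m : M => (1 : ℝ) ⊗ₜ[ℤ] m) '' (T : Set M))) ↔
      ∃ K : ℕ, 0 < K ∧ ∃ c : M → ℕ, K • m = ∑ i ∈ T, c i • i := by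
  constructor
  · intro hm
    rcases farkas_int T id m with h | ⟨ℓ, hℓ, hx⟩
    · exact h
    · exact absurd (nonneg_of_tmul_mem_hull T ℓ hℓ hm) (not_le.mpr hx)
  · rintro ⟨K, hK, c, h⟩
    set σ := PointedCone.hull ℝ ((fun m : M => (1 : ℝ) ⊗ₜ[ℤ] m) '' (T : Set M))
    have h1 : K • m ∈ latticePoints σ := by
      rw [h]
      exact sum_mem fun i hi => nsmul_mem
        (show i ∈ latticePoints σ from Submodule.subset_span ⟨i, hi, rfl⟩) _
    have h2 : (1 : ℝ) ⊗ₜ[ℤ] (K • m) ∈ σ := h1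
    have hK0 : 0 ≤ (K : ℝ)⁻¹ := by positivity
    have h3 : (1 : ℝ) ⊗ₜ[ℤ] m = (⟨(K : ℝ)⁻¹, hK0⟩ : {r : ℝ // 0 ≤ r}) •
        ((1 : ℝ) ⊗ₜ[ℤ] (K • m)) := by
      change _ = (K : ℝ)⁻¹ • ((1 : ℝ) ⊗ₜ[ℤ] (K • m))
      rw [TensorProduct.tmul_smul, ← Nat.cast_smul_eq_nsmul ℝ, smul_smul, inv_mul_cancel₀
        (by positivity), one_smul]
    change _ ∈ σ
    rw [h3]
    exact Submodule.smul_mem _ _ h2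

/-- **Gordan's lemma**: the saturation of a finitely generated submonoid of a lattice is finitely
generated. -/
theorem fg_of_saturation [Module.Free ℤ M] [Module.Finite ℤ M] (T : Finset M)
    (S : AddSubmonoid M)
    (hS : ∀ m, m ∈ S ↔ ∃ K : ℕ, 0 < K ∧ ∃ c : M → ℕ, K • m = ∑ i ∈ T, c i • i) : S.FG := by
  let b := Module.Free.chooseBasis ℤ M
  let B : Module.Free.ChooseBasisIndex ℤ M → ℤ := fun j => ∑ i ∈ T, |b.equivFun i j|
  let F : Set M := {m | m ∈ S ∧ b.equivFun m ∈ Set.Icc (-B) B}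
  have hF : F.Finite :=
    ((Set.finite_Icc (-B) B).preimage b.equivFun.injective.injOn).subset fun m hm => hm.2
  have hTS : ∀ m ∈ T, m ∈ S := by
    classical
    intro m hm
    refine (hS m).mpr ⟨1, one_pos, Pi.single m 1, ?_⟩
    rw [Finset.sum_eq_single_of_mem m hm]
    · simp
    · intro i _ hi
      simp [Pi.single_eq_of_ne hi]
  rw [AddSubmonoid.fg_iff]
  refine ⟨(T : Set M) ∪ F, le_antisymm ?_ ?_, T.finite_toSet.union hF⟩
  · rw [AddSubmonoid.closure_le]
    rintro m (hm | hm)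
    · exact hTS m hm
    · exact hm.1
  · intro m hm
    obtain ⟨K, hK, c, h⟩ := (hS m).mp hm
    -- Subtracting integer parts leaves coefficients in [0, 1), which forces r into the finite box
    -- F.
    set r := m - ∑ i ∈ T, (c i / K) • i with hr
    have hKr : K • r = ∑ i ∈ T, (c i % K) • i := by
      rw [hr, smul_sub, h, Finset.smul_sum, ← Finset.sum_sub_distrib]
      refine Finset.sum_congr rfl fun i _ => ?_
      rw [smul_smul, sub_eq_iff_eq_add, ← add_smul, Nat.mod_add_div]
    have hrF : r ∈ F := by
      refine ⟨(hS r).mpr ⟨K, hK, _, hKr⟩, ?_⟩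
      have hj : ∀ j, |b.equivFun r j| ≤ B j := by
        intro j
        have h1 : (K : ℤ) * b.equivFun r j = ∑ i ∈ T, ((c i % K : ℕ) : ℤ) * b.equivFun i j := by
          have := congrArg (fun y => b.equivFun y j) hKr
          simpa [map_sum, Finset.sum_apply] using this
        have h2 : (K : ℤ) * |b.equivFun r j| ≤ K * B j := by
          rw [← abs_of_nonneg (show (0 : ℤ) ≤ K by positivity), ← abs_mul, abs_of_nonneg
            (show (0 : ℤ) ≤ K by positivity), h1, Finset.mul_sum]
          refine (Finset.abs_sum_le_sum_abs _ _).trans (Finset.sum_le_sum fun i _ => ?_)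
          rw [abs_mul, abs_of_nonneg (by positivity)]
          gcongr
          exact (Nat.mod_lt _ hK).le
        exact le_of_mul_le_mul_left h2 (by exact_mod_cast hK)
      exact ⟨fun j => (abs_le.mp (hj j)).1, fun j => (abs_le.mp (hj j)).2⟩
    have hm' : m = r + ∑ i ∈ T, (c i / K) • i := by rw [hr]; abel
    rw [hm']
    refine add_mem (AddSubmonoid.subset_closure ?_) (sum_mem fun i hi => nsmul_mem
      (AddSubmonoid.subset_closure ?_) _)
    · exact Or.inr hrF
    · exact Or.inl hi

end LatticePoints

/-! ### Weights and integral closure -/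

section Weight

variable {M : Type*} [AddCommGroup M] {k : Type*} [Field k] {S : AddSubmonoid M}

theorem exists_add_of_coeff_mul_ne_zero {f g : AddMonoidAlgebra k S} {s : S}
    (h : (f * g).coeff s ≠ 0) :
    ∃ a b : S, f.coeff a ≠ 0 ∧ g.coeff b ≠ 0 ∧ a + b = s := by
  classical
  contrapose! h
  rw [AddMonoidAlgebra.coeff_mul]
  refine Finset.sum_eq_zero fun a ha => Finset.sum_eq_zero fun b hb => if_neg ?_
  exact h a b (Finsupp.mem_support_iff.mp ha) (Finsupp.mem_support_iff.mp hb)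

/-- The ideal of all `f` whose monomials have weight at least `b` with respect to a weight `α`
that is nonnegative on `S`. -/
def weightIdeal (k : Type*) [Field k] {S : AddSubmonoid M} (α : M →+ ℤ) (hα : ∀ s ∈ S, 0 ≤ α s)
    (b : ℤ) : Ideal (AddMonoidAlgebra k S) where
  carrier := {f | ∀ s : S, f.coeff s ≠ 0 → b ≤ α s}
  zero_mem' := by simp
  add_mem' := by
    intro f g hf hg s hs
    by_cases h : f.coeff s = 0
    · refine hg s fun h' => hs ?_
      rw [AddMonoidAlgebra.coeff_add, Finsupp.add_apply, h, h', add_zero]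
    · exact hf s h
  smul_mem' := by
    intro c f hf s hs
    obtain ⟨x, y, -, hy, rfl⟩ := exists_add_of_coeff_mul_ne_zero hs
    have := hα x x.2
    have := hf y hy
    rw [AddSubmonoid.coe_add, map_add]
    linarith

variable {α : M →+ ℤ} {hα : ∀ s ∈ S, 0 ≤ α s}

theorem span_single_le_weightIdeal {A : Set S} {b : ℤ} (hA : ∀ s ∈ A, b ≤ α s) :
    Ideal.span ((fun s : S => AddMonoidAlgebra.single s (1 : k)) '' A) ≤
      weightIdeal k α hα b := by
  classical
  rw [Ideal.span_le]
  rintro _ ⟨a, ha, rfl⟩ s hs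
  rw [AddMonoidAlgebra.coeff_single, Finsupp.single_apply] at hs
  by_cases h : a = s
  · exact h ▸ hA a ha
  · simp [h] at hs

theorem pow_le_weightIdeal {J : Ideal (AddMonoidAlgebra k S)} {b : ℤ}
    (hJ : J ≤ weightIdeal k α hα b) (n : ℕ) : J ^ n ≤ weightIdeal k α hα (n * b) := by
  induction n with
  | zero =>
    intro f _ s _
    simpa using hα s s.2
  | succ n ih =>
    rw [pow_succ, Ideal.mul_le]
    intro f hf g hg s hs
    obtain ⟨x, y, hx, hy, rfl⟩ := exists_add_of_coeff_mul_ne_zero hs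
    have h1 := ih hf x hx
    have h2 := hJ hg y hy
    rw [AddSubmonoid.coe_add, map_add]
    push_cast
    linarith

/-- The powers of an element that is integral over `J` lie in powers of `J`, up to a bounded
shift. -/
theorem IsIntegralOverIdeal.exists_pow_mem {R : Type*} [CommRing R] {J : Ideal R} {r : R}
    (h : IsIntegralOverIdeal J r) : ∃ n : ℕ, ∀ j : ℕ, r ^ j ∈ J ^ (j + 1 - n) := by
  obtain ⟨n, a, ha, h⟩ := h
  refine ⟨n, fun j => ?_⟩
  induction j using Nat.strong_induction_on with
  | _ j ih =>
    by_cases hj : j < n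
    · rw [show j + 1 - n = 0 by omega, pow_zero, Ideal.one_eq_top]
      trivial
    push Not at hj
    have h1 : r ^ j = -∑ i ∈ Finset.Icc 1 n, a i * r ^ (j - i) := by
      have h2 : r ^ j = r ^ n * r ^ (j - n) := by rw [← pow_add]; congr 1; omega
      rw [h2, eq_neg_of_add_eq_zero_left h, neg_mul, Finset.sum_mul]
      congr 1
      refine Finset.sum_congr rfl fun i hi => ?_
      rw [Finset.mem_Icc] at hi
      rw [mul_assoc, ← pow_add]
      congr 2
      omega
    rw [h1]
    refine neg_mem (sum_mem fun i hi => ?_)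
    have hi' := Finset.mem_Icc.mp hi
    have h3 := Ideal.mul_mem_mul (ha i hi) (ih (j - i) (by omega))
    rw [← pow_add] at h3
    exact Ideal.pow_le_pow_right (by omega) h3

/-- Frobenius is additive, and torsion-freeness keeps the exponents p^r • a distinct, so no
cancellation occurs. -/
theorem coeff_pow_char_pow [IsAddTorsionFree M] (p : ℕ) [Fact p.Prime] [CharP k p]
    (f : AddMonoidAlgebra k S) (r : ℕ) (s : S) :
    (f ^ p ^ r).coeff (p ^ r • s) = f.coeff s ^ p ^ r := by
  classical
  have : CharP (AddMonoidAlgebra k S) p :=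
    charP_of_injective_algebraMap (algebraMap k (AddMonoidAlgebra k S)).injective p
  have hpr : p ^ r ≠ 0 := pow_ne_zero _ (Fact.out : p.Prime).ne_zero
  induction f using AddMonoidAlgebra.induction_linear with
  | zero => rw [zero_pow hpr, AddMonoidAlgebra.coeff_zero, Finsupp.zero_apply,
      Finsupp.zero_apply, zero_pow hpr]
  | add f g hf hg =>
    rw [add_pow_char_pow, AddMonoidAlgebra.coeff_add, Finsupp.add_apply, hf, hg,
      AddMonoidAlgebra.coeff_add, Finsupp.add_apply, add_pow_char_pow]
  | single a c =>
    rw [AddMonoidAlgebra.single_pow, AddMonoidAlgebra.coeff_single, Finsupp.single_apply,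
      AddMonoidAlgebra.coeff_single, Finsupp.single_apply]
    by_cases h : a = s
    · simp [h]
    · have h' : p ^ r • a ≠ p ^ r • s := fun h' => h (Subtype.ext
        (nsmul_right_injective hpr (by simpa using congrArg Subtype.val h')))
      rw [if_neg h, if_neg h', zero_pow hpr]

/-- If s occurs in f, then p^r • s occurs in f^(p^r), which lies in J^(p^r + 1 - n); hence p^r α(s)
≥ (p^r + 1 - n)b. Let r grow. -/
theorem idealClosure_le_weightIdeal [IsAddTorsionFree M] (p : ℕ) [Fact p.Prime] [CharP k p]
    {J : Ideal (AddMonoidAlgebra k S)} {b : ℤ} (hJ : J ≤ weightIdeal k α hα b) :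
    idealClosure J ≤ weightIdeal k α hα b := by
  intro f hf s hs
  obtain ⟨n, hn⟩ := IsIntegralOverIdeal.exists_pow_mem hf
  by_contra! hlt
  -- If α(s) ≤ b - 1, the inequality would give p^r ≤ nb - b ≤ r.
  set r := n + (n * b).natAbs + b.natAbs
  have hr : r < p ^ r := Nat.lt_pow_self (Fact.out : p.Prime).one_lt
  have h1 := pow_le_weightIdeal hJ _ (hn (p ^ r)) (p ^ r • s)
    (by rw [coeff_pow_char_pow]; exact pow_ne_zero _ hs)
  rw [AddSubmonoidClass.coe_nsmul, map_nsmul, nsmul_eq_mul,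
    Nat.cast_sub (show n ≤ p ^ r + 1 by omega)] at h1
  push_cast at h1
  have h2 : ((p : ℤ) ^ r) * α s ≤ (p : ℤ) ^ r * (b - 1) :=
    mul_le_mul_of_nonneg_left (by omega) (by positivity)
  have h3 : ((r : ℕ) : ℤ) < (p : ℤ) ^ r := by exact_mod_cast hr
  have h4 : (r : ℤ) = n + |(n * b : ℤ)| + |b| := by simp [r]
  have h5 := le_abs_self (n * b : ℤ)
  have h6 := neg_abs_le b
  nlinarith

end Weight

/-! ### Iterates of toric maps -/

section Toric

variable {M : Type*} [AddCommGroup M] {k : Type*} [Field k] {S : AddSubmonoid M}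

theorem coeff_toLaurent_coe (f : AddMonoidAlgebra k S) (s : S) :
    (toLaurent S f).coeff (s : M) = f.coeff s :=
  Finsupp.mapDomain_apply Subtype.val_injective f.coeff s

theorem exists_of_coeff_toLaurent_ne_zero {f : AddMonoidAlgebra k S} {m : M}
    (h : (toLaurent S f).coeff m ≠ 0) : ∃ s : S, (s : M) = m := by
  by_contra! hm
  exact h (Finsupp.mapDomain_of_notMem_range f.coeff m (by rintro ⟨s, hs⟩; exact hm s hs))

theorem toLaurent_single (s : S) (c : k) :
    toLaurent S (AddMonoidAlgebra.single s c) = AddMonoidAlgebra.single (s : M) c :=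
  AddMonoidAlgebra.mapDomain_single

theorem coeff_canonicalSplitting [IsAddTorsionFree M] {q : ℕ} (hq : q ≠ 0) (κ : k →+ k)
    (F : AddMonoidAlgebra k M) (m : M) :
    (canonicalSplitting q κ F).coeff m = κ (F.coeff (q • m)) := by
  classical
  induction F using AddMonoidAlgebra.induction_linear with
  | zero => simp
  | add f g hf hg => simp [hf, hg]
  | single a c =>
    have h1 : canonicalSplitting q κ (AddMonoidAlgebra.single a c) =
        (if h : ∃ m' : M, a = q • m' then (AddMonoidAlgebra.singleAddHom h.choose).comp κ
          else 0) c := by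
      simp only [canonicalSplitting, AddMonoidHom.comp_apply]
      exact Finsupp.liftAddHom_apply_single _ a c
    rw [h1, AddMonoidAlgebra.coeff_single, Finsupp.single_apply]
    split_ifs with h h2 h2
    · have h3 := h.choose_spec
      have : h.choose = m := nsmul_right_injective hq (h3.symm.trans h2)
      simp [this]
    · have h3 := h.choose_spec
      have : h.choose ≠ m := fun h4 => h2 (h4 ▸ h3)
      simp [this]
    · exact absurd ⟨m, h2⟩ h
    · simp

variable {q : ℕ} {κ : k →+ k} {w : M} {φ : AddMonoid.End (AddMonoidAlgebra k S)}

/-- The successive shifts by w add up to the geometric sum. -/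
theorem IsToricMap.coeff_pow_apply [IsAddTorsionFree M] (hq : q ≠ 0) (hφ : IsToricMap q κ w φ)
    (n : ℕ) (f : AddMonoidAlgebra k S) (m : M) :
    (toLaurent S ((φ ^ n : AddMonoid.End (AddMonoidAlgebra k S)) f)).coeff m =
      κ^[n] ((toLaurent S f).coeff (q ^ n • m + (∑ i ∈ Finset.range n, q ^ i) • w)) := by
  induction n generalizing m with
  | zero => simp
  | succ n ih =>
    rw [pow_succ', AddMonoid.End.coe_mul, Function.comp_apply, hφ, coeff_canonicalSplitting hq,
      AddMonoidAlgebra.coeff_single_mul_apply, one_mul, neg_neg, ih,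
      Function.iterate_succ_apply']
    have h : q ^ n • (w + q • m) + (∑ i ∈ Finset.range n, q ^ i) • w =
        q ^ (n + 1) • m + (∑ i ∈ Finset.range (n + 1), q ^ i) • w := by
      rw [Finset.sum_range_succ, pow_succ, add_smul, smul_add, smul_smul]
      abel
    rw [h]

theorem IsFrobeniusSplitting.iterate_pow (hκ : IsFrobeniusSplitting q κ) (n : ℕ) (a : k) :
    κ^[n] (a ^ q ^ n) = a := by
  induction n generalizing a with
  | zero => simp
  | succ n ih =>
    rw [Function.iterate_succ_apply, pow_succ, pow_mul]
    have := hκ.2 (a ^ q ^ n) 1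
    rw [mul_one, hκ.1, mul_one] at this
    rw [this, ih]

end Toric

/-! ### Integral closures of powers of monomial ideals -/

section MonomialClosure

variable {M : Type*} [AddCommGroup M] [Module.Free ℤ M] {k : Type*} [Field k]
  {S : AddSubmonoid M}

/-- The integral equation is X^K - r^K = 0. -/
theorem mem_idealClosure_of_pow_mem {R : Type*} [CommRing R] {J : Ideal R} {r : R} {K : ℕ}
    (hK : 0 < K) (h : r ^ K ∈ J ^ K) : r ∈ idealClosure J := by
  refine ⟨K, fun i => if i = K then -r ^ K else 0, fun i _ => ?_, ?_⟩
  · by_cases hi : i = K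
    · subst hi
      simpa using h
    · simp [hi]
  · rw [Finset.sum_eq_single_of_mem K (Finset.mem_Icc.mpr ⟨hK, le_rfl⟩)]
    · simp
    · intro i _ hi
      simp [hi]

/-- A monomial lies in the integral closure of `𝔞 ^ N`, for a monomial ideal `𝔞`, if its exponent
satisfies all inequalities that define the `N`-th multiple of the Newton polyhedron of `𝔞`. -/
theorem single_mem_idealClosure_of_weight (T : Finset M)
    (hS : ∀ m, m ∈ S ↔ ∃ K : ℕ, 0 < K ∧ ∃ c : M → ℕ, K • m = ∑ i ∈ T, c i • i)
    (hTS : ∀ m ∈ T, m ∈ S) (A : Finset S) (N : ℕ) (u : M)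
    (h : ∀ (α : M →+ ℤ) (μ : ℤ), (∀ m ∈ T, 0 ≤ α m) → (∀ a ∈ A, μ ≤ α a) → N * μ ≤ α u) :
    ∃ hu : u ∈ S, AddMonoidAlgebra.single (⟨u, hu⟩ : S) (1 : k) ∈ idealClosure
      (Ideal.span ((fun s : S => AddMonoidAlgebra.single s (1 : k)) '' (A : Set S)) ^ N) := by
  set J := Ideal.span ((fun s : S => AddMonoidAlgebra.single s (1 : k)) '' (A : Set S)) with hJ
  -- Homogenization: the last coordinate counts factors from 𝔞, so a relation for K • (u, N) puts
  -- the K-th power of x^u in 𝔞^(NK).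
  let g : M ⊕ S → M × ℤ := Sum.elim (fun m => (m, 0)) (fun a => ((a : M), 1))
  rcases farkas_int (T.disjSum A) g (u, (N : ℤ)) with ⟨K, hK, c, hc⟩ | ⟨ℓ, hℓ, hx⟩
  · rw [Finset.sum_disjSum] at hc
    have h1 : K • u = (∑ m ∈ T, c (.inl m) • m) + ∑ a ∈ A, c (.inr a) • (a : M) := by
      have := congrArg Prod.fst hc
      simpa [g, Prod.fst_sum] using this
    have h2 : N * K = ∑ a ∈ A, c (.inr a) := by
      have := congrArg Prod.snd hc
      simp only [g, Sum.elim_inl, Sum.elim_inr, Prod.smul_mk, smul_zero, nsmul_eq_mul, mul_one,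
        Prod.snd_add, Prod.snd_sum, Finset.sum_const_zero, zero_add] at this
      rw [mul_comm]
      exact_mod_cast this
    have hv : ∑ m ∈ T, c (.inl m) • m ∈ S := sum_mem fun m hm => nsmul_mem (hTS m hm) _
    have hKu : K • u ∈ S := by
      rw [h1]
      exact add_mem hv (sum_mem fun a _ => nsmul_mem a.2 _)
    obtain ⟨K', hK', c', h3⟩ := (hS _).mp hKu
    have hu : u ∈ S := (hS u).mpr ⟨K' * K, Nat.mul_pos hK' hK, c', by rw [mul_smul, h3]⟩
    refine ⟨hu, mem_idealClosure_of_pow_mem hK ?_⟩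
    have h4 : K • (⟨u, hu⟩ : S) = (⟨_, hv⟩ : S) + ∑ a ∈ A, c (.inr a) • a := by
      apply Subtype.ext
      simpa using h1
    have h5 : AddMonoidAlgebra.single (⟨u, hu⟩ : S) (1 : k) ^ K =
        AddMonoidAlgebra.single (⟨_, hv⟩ : S) (1 : k) *
          ∏ a ∈ A, AddMonoidAlgebra.single a (1 : k) ^ c (.inr a) := by
      simp only [AddMonoidAlgebra.single_pow, one_pow]
      rw [AddMonoidAlgebra.prod_single, AddMonoidAlgebra.single_mul_single, h4]
      simp
    rw [h5, ← pow_mul, h2, ← Finset.prod_pow_eq_pow_sum]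
    exact Ideal.mul_mem_left _ _ (Ideal.prod_mem_prod fun a ha =>
      Ideal.pow_mem_pow (Ideal.subset_span (Set.mem_image_of_mem _ ha)) _)
  · exfalso
    have hadd : ∀ (m : M) (c : ℤ), ℓ (m, c) = ℓ (m, 0) + c * ℓ (0, 1) := by
      intro m c
      have : ((m, c) : M × ℤ) = (m, 0) + c • (0, 1) := by simp
      rw [this, map_add, map_zsmul, smul_eq_mul]
    -- A separating functional restricts to a weight on M, and minus its value on (0, 1) is a lower
    -- bound for that weight on A.
    have := h (ℓ.comp (AddMonoidHom.inl M ℤ)) (-ℓ (0, 1))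
      (fun m hm => hℓ (.inl m) (Finset.inl_mem_disjSum.mpr hm))
      (fun a ha => by
        have := hℓ (.inr a) (Finset.inr_mem_disjSum.mpr ha)
        simp only [g, Sum.elim_inr] at this
        rw [hadd] at this
        simp only [AddMonoidHom.comp_apply, AddMonoidHom.inl_apply]
        linarith)
    simp only [AddMonoidHom.comp_apply, AddMonoidHom.inl_apply] at this
    rw [hadd] at hx
    linarith

end MonomialClosure

/-! ### Weights of fixed ideals -/

section FixedIdeals

variable {M : Type*} [AddCommGroup M] {k : Type*} [Field k] {S : AddSubmonoid M}

/-- The subgroup of all elements whose exponents satisfy `P`. -/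
def supportedSubgroup (k : Type*) [Field k] (P : S → Prop) :
    AddSubgroup (AddMonoidAlgebra k S) where
  carrier := {f | ∀ s : S, f.coeff s ≠ 0 → P s}
  zero_mem' := by simp
  add_mem' := by
    intro f g hf hg s hs
    by_cases h : f.coeff s = 0
    · refine hg s fun h' => hs ?_
      rw [AddMonoidAlgebra.coeff_add, Finsupp.add_apply, h, h', add_zero]
    · exact hf s h
  neg_mem' := by
    intro f hf s hs
    exact hf s (by simpa using hs)

variable {p e : ℕ} {κ : k →+ k} {w : M} {φ : AddMonoid.End (AddMonoidAlgebra k S)}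
  {𝔞 I : Ideal (AddMonoidAlgebra k S)} {t : ℚ} {α : M →+ ℤ} {hα : ∀ s ∈ S, 0 ≤ α s} {μ : ℤ}

/-- If s comes from φ^n, then q^n s + (1+⋯+q^(n-1))w = x + z with α(x) ≥ t(q^n-1)μ. Apply α,
multiply by q-1 and use (q-1)(1+⋯+q^(n-1)) = q^n-1. -/
theorem cartierSum_le_supportedSubgroup [IsAddTorsionFree M] [Fact p.Prime] [CharP k p]
    (hφ : IsToricMap (p ^ e) κ w φ) (h𝔞 : 𝔞 ≤ weightIdeal k α hα μ) :
    cartierSum p e φ 𝔞 t I ≤ supportedSubgroup k fun s => ∃ n : ℕ, 0 < n ∧ ∃ h ∈ I, ∃ z : S,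
      h.coeff z ≠ 0 ∧ ((p : ℚ) ^ e - 1) * α z + α w - ((p : ℚ) ^ e - 1) * t * μ ≤
        ((p : ℚ) ^ e) ^ n *
          (((p : ℚ) ^ e - 1) * α s + α w - ((p : ℚ) ^ e - 1) * t * μ) := by
  have hp1 : (1 : ℚ) ≤ (p : ℚ) ^ e :=
    one_le_pow₀ (by exact_mod_cast (Fact.out : p.Prime).one_lt.le)
  refine iSup_le fun n => iSup_le fun N => iSup_le fun ⟨hn, hN⟩ => ?_
  rintro _ ⟨g, hg, rfl⟩ s hs
  have hprod : g ∈ supportedSubgroup k fun z : S => ∃ x y : S, (N * μ ≤ α x) ∧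
      (∃ h ∈ I, h.coeff y ≠ 0) ∧ x + y = z := by
    refine Submodule.mul_induction_on hg ?_ fun x y hx hy => add_mem hx hy
    intro x hx y hy z hz
    obtain ⟨a, b, ha, hb, hab⟩ := exists_add_of_coeff_mul_ne_zero hz
    exact ⟨a, b, idealClosure_le_weightIdeal p (pow_le_weightIdeal h𝔞 N) hx a ha,
      ⟨y, hy, hb⟩, hab⟩
  have hs' : (toLaurent S ((φ ^ n : AddMonoid.End (AddMonoidAlgebra k S)) g)).coeff s ≠ 0 := by
    rw [coeff_toLaurent_coe]
    exact hs
  rw [hφ.coeff_pow_apply (pow_ne_zero _ (Fact.out : p.Prime).ne_zero)] at hs'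
  have hs2 : (toLaurent S g).coeff
      ((p ^ e) ^ n • (s : M) + (∑ i ∈ Finset.range n, (p ^ e) ^ i) • w) ≠ 0 := by
    intro h0
    exact hs' (by rw [h0]; exact Function.iterate_fixed (map_zero κ) n)
  obtain ⟨v, hv⟩ := exists_of_coeff_toLaurent_ne_zero hs2
  rw [← hv, coeff_toLaurent_coe] at hs2
  obtain ⟨x, y, hx, ⟨h, hhI, hy⟩, hxy⟩ := hprod v hs2
  refine ⟨n, hn, h, hhI, y, hy, ?_⟩
  have h1 : (α x : ℚ) + α y =
      ((p : ℚ) ^ e) ^ n * α s + (∑ i ∈ Finset.range n, ((p : ℚ) ^ e) ^ i) * α w := by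
    have := congrArg (fun m : M => (α m : ℚ)) hv
    rw [← hxy] at this
    simpa using this
  have h2 := geom_sum_mul ((p : ℚ) ^ e) n
  have h3 : (N : ℚ) * μ ≤ α x := by exact_mod_cast hx
  rw [hN, pow_mul] at h3
  have h4 := mul_le_mul_of_nonneg_left h3 (sub_nonneg.mpr hp1)
  have h5 := congrArg (fun z => ((p : ℚ) ^ e - 1) * z) h1
  have h6 := congrArg (fun z => z * (α w : ℚ)) h2
  linarith

/-- The exponents of a fixed ideal lie in the Newton polyhedron of `𝔞 ^ t`, translated by
`-w / (q - 1)`. -/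
theorem IsCartierFixed.weight_nonneg [IsAddTorsionFree M] [Fact p.Prime] [CharP k p]
    (he : 0 < e) (hφ : IsToricMap (p ^ e) κ w φ) (h𝔞 : 𝔞 ≤ weightIdeal k α hα μ)
    (hI : IsCartierFixed p e φ 𝔞 t I) {f : AddMonoidAlgebra k S} (hf : f ∈ I) {s : S}
    (hs : f.coeff s ≠ 0) :
    0 ≤ ((p : ℚ) ^ e - 1) * α s + α w - ((p : ℚ) ^ e - 1) * t * μ := by
  set q : ℚ := (p : ℚ) ^ e with hq
  have hq2 : 2 ≤ q := by
    have h1 : (2 : ℚ) ≤ p := by exact_mod_cast (Fact.out : p.Prime).two_le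
    exact h1.trans (le_self_pow₀ (by linarith) he.ne')
  set D : ℚ := |α w - (q - 1) * t * μ|
  -- Since α ≥ 0 on S, -D bounds X below; each pullback through a fixed ideal improves the bound by
  -- a factor of at least 2.
  have key : ∀ j : ℕ, ∀ f ∈ I, ∀ s : S, f.coeff s ≠ 0 →
      -D ≤ 2 ^ j * ((q - 1) * α s + α w - (q - 1) * t * μ) := by
    intro j
    induction j with
    | zero =>
      intro f _ s _
      have h1 : 0 ≤ (q - 1) * (α s : ℚ) :=
        mul_nonneg (by linarith) (by exact_mod_cast hα s s.2)
      have h2 := neg_abs_le (α w - (q - 1) * t * μ)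
      rw [pow_zero, one_mul]
      linarith
    | succ j ih =>
      intro f hf s hs
      have hf' : f ∈ cartierSum p e φ 𝔞 t I := by
        rw [show cartierSum p e φ 𝔞 t I = _ from hI]
        exact hf
      obtain ⟨n, hn, h, hh, z, hz, hle⟩ := cartierSum_le_supportedSubgroup hφ h𝔞 hf' s hs
      have h1 := ih h hh z hz
      set X := (q - 1) * (α s : ℚ) + α w - (q - 1) * t * μ
      by_cases hX : 0 ≤ X
      · exact (neg_nonpos.mpr (abs_nonneg _)).trans (mul_nonneg (by positivity) hX)
      · have h2 : 2 ≤ q ^ n := hq2.trans (le_self_pow₀ (by linarith) hn.ne')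
        have h3 : q ^ n * X ≤ 2 * X := mul_le_mul_of_nonpos_right h2 (by linarith)
        calc -D ≤ 2 ^ j * _ := h1
          _ ≤ 2 ^ j * (2 * X) := by gcongr; exact hle.trans h3
          _ = 2 ^ (j + 1) * X := by ring
  by_contra! hX
  obtain ⟨j, hj⟩ := pow_unbounded_of_one_lt
    (D / -((q - 1) * α s + α w - (q - 1) * t * μ)) (one_lt_two : (1 : ℚ) < 2)
  rw [div_lt_iff₀ (by linarith)] at hj
  have := key j f hf s hs
  linarith

end FixedIdeals

/-! ### Extracting monomials -/

section Extraction

/-- A nonzero lattice vector is divisible by only finitely many powers of q; a functional nonzero on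
it gives the bound. -/
theorem exists_forall_eq_smul_imp_eq_zero {M : Type*} [AddCommGroup M] [Module.Free ℤ M] {q : ℕ}
    (hq : 1 < q) (D : Finset M) :
    ∃ B : ℕ, ∀ n ≥ B, ∀ δ ∈ D, ∀ d : M, δ = q ^ n • d → d = 0 := by
  have : IsAddTorsionFree M := .of_isTorsionFree ℤ M
  have hloc : ∀ δ : M, ∃ B : ℕ, ∀ n ≥ B, ∀ d : M, δ = q ^ n • d → d = 0 := by
    intro δ
    by_cases hδ : δ = 0
    · refine ⟨0, fun n _ d hd => ?_⟩
      have hd' : (q ^ n : ℕ) • d = 0 := by rw [← hd, hδ]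
      exact (smul_eq_zero.mp hd').resolve_left (pow_ne_zero _ (by omega))
    · obtain ⟨ℓ, hℓ⟩ := exists_addMonoidHom_neg hδ
      refine ⟨(ℓ δ).natAbs, fun n hn d hd => ?_⟩
      exfalso
      have h1 : (ℓ δ).natAbs = q ^ n * (ℓ d).natAbs := by
        rw [hd, map_nsmul, nsmul_eq_mul, Int.natAbs_mul, Int.natAbs_natCast]
      have h2 : (ℓ d).natAbs ≠ 0 := by
        intro h0
        rw [h0, mul_zero] at h1
        omega
      have h3 : q ^ n ≤ q ^ n * (ℓ d).natAbs := Nat.le_mul_of_pos_right _ (by omega)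
      have h4 : n < q ^ n := Nat.lt_pow_self hq
      omega
  choose B hB using hloc
  exact ⟨D.sup B, fun n hn δ hδ d hd => hB δ n ((Finset.le_sup hδ).trans hn) d hd⟩

theorem exists_nat_eq_mul_pow_sub_one {p e : ℕ} (hp : p.Prime) {t : ℚ} (ht : 0 ≤ t)
    (htp : ¬ p ∣ t.den) (B : ℕ) :
    ∃ n N : ℕ, B ≤ n ∧ 0 < n ∧ (N : ℚ) = t * ((p : ℚ) ^ (e * n) - 1) := by
  have hn0 : 0 < t.den.totient := Nat.totient_pos.mpr t.den_pos
  -- By Euler, p^(en) ≡ 1 modulo the denominator when n is a multiple of its totient; B + 1 makes n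
  -- positive and at least B.
  refine ⟨t.den.totient * (B + 1), t.num.toNat * ((p ^ (e * (t.den.totient * (B + 1))) - 1) /
    t.den), ?_, by positivity, ?_⟩
  · exact (Nat.le_succ B).trans (Nat.le_mul_of_pos_left _ hn0)
  · set m := e * (t.den.totient * (B + 1)) with hm
    have h1 : p ^ m ≡ 1 [MOD t.den] := by
      rw [hm, show e * (t.den.totient * (B + 1)) = t.den.totient * (e * (B + 1)) by ring, pow_mul]
      simpa using (Nat.ModEq.pow_totient ((Nat.Prime.coprime_iff_not_dvd hp).mpr htp)).pow
        (e * (B + 1))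
    have h2 : t.den ∣ p ^ m - 1 := (Nat.modEq_iff_dvd' (Nat.one_le_pow _ _ hp.pos)).mp h1.symm
    have h3 : ((t.num.toNat : ℕ) : ℚ) = t.num := by
      exact_mod_cast congrArg (Int.cast : ℤ → ℚ) (Int.toNat_of_nonneg (Rat.num_nonneg.mpr ht))
    have h4 : (t.den : ℚ) ≠ 0 := by exact_mod_cast t.den_nz
    rw [Nat.cast_mul, h3, Nat.cast_div h2 h4, Nat.cast_sub (Nat.one_le_pow _ _ hp.pos)]
    push_cast
    conv_rhs => rw [← Rat.num_div_den t]
    ring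

variable {M : Type*} [AddCommGroup M] {k : Type*} [Field k] {S : AddSubmonoid M}
  {q : ℕ} {κ : k →+ k} {w : M} {φ : AddMonoid.End (AddMonoidAlgebra k S)}

/-- The shift by u carries s to the exponent that φ^n sends back to s; another exponent z survives
only if z - s ∈ q^n M. The factor c^(q^n-1) turns c into c^(q^n), whose image under κ^n is c, so k
need not be perfect. -/
theorem IsToricMap.pow_single_mul_eq_single [IsAddTorsionFree M] (hq : q ≠ 0)
    (hκ : IsFrobeniusSplitting q κ) (hφ : IsToricMap q κ w φ) {n : ℕ} {f : AddMonoidAlgebra k S}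
    {s u : S} (hu : (u : M) + s = q ^ n • (s : M) + (∑ i ∈ Finset.range n, q ^ i) • w)
    (hn : ∀ z : S, f.coeff z ≠ 0 → ∀ d : M, (z : M) - s = q ^ n • d → d = 0) :
    (φ ^ n : AddMonoid.End (AddMonoidAlgebra k S))
      (AddMonoidAlgebra.single u (f.coeff s ^ (q ^ n - 1)) * f) =
      AddMonoidAlgebra.single s (f.coeff s) := by
  classical
  ext m
  rw [← coeff_toLaurent_coe, hφ.coeff_pow_apply hq, map_mul, toLaurent_single,
    AddMonoidAlgebra.coeff_single_mul_apply, AddMonoidAlgebra.coeff_single, Finsupp.single_apply]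
  split_ifs with hm
  · subst hm
    rw [← hu, neg_add_cancel_left, coeff_toLaurent_coe, ← pow_succ,
      Nat.sub_add_cancel (Nat.one_le_pow _ _ (Nat.pos_of_ne_zero hq)), hκ.iterate_pow]
  · have h0 : (toLaurent S f).coeff
        (-(u : M) + (q ^ n • (m : M) + (∑ i ∈ Finset.range n, q ^ i) • w)) = 0 := by
      by_contra h
      obtain ⟨z, hz⟩ := exists_of_coeff_toLaurent_ne_zero h
      rw [← hz, coeff_toLaurent_coe] at h
      have h1 := hn z h (m - s) (by
        rw [hz, smul_sub, ← sub_eq_zero]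
        rw [← sub_eq_zero] at hu
        rw [← neg_eq_zero, ← hu]
        abel)
      exact hm (Subtype.ext (sub_eq_zero.mp h1).symm)
    rw [h0, mul_zero]
    exact Function.iterate_fixed (map_zero κ) n

end Extraction

/-! ### Intersections of fixed ideals. -/

theorem cartierSum_mono {R : Type*} [CommRing R] {p e : ℕ} {φ : AddMonoid.End R} {𝔞 : Ideal R}
    {t : ℚ} {I J : Ideal R} (h : I ≤ J) : cartierSum p e φ 𝔞 t I ≤ cartierSum p e φ 𝔞 t J :=
  iSup_mono fun _ => iSup_mono fun _ => iSup_mono fun _ =>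
    AddSubgroup.map_mono fun _ hx => Ideal.mul_mono_right h hx

end ToricFixed

open ToricFixed in
theorem mainTheorem7
    {M : Type*} [AddCommGroup M] [Module.Free ℤ M] [Module.Finite ℤ M]
    (σ : PointedCone ℝ (TensorProduct ℤ ℝ M)) (hσ : ToricFixed.IsRationalPolyhedral σ)
    (p : ℕ) (hp : p.Prime) {k : Type*} [Field k] [CharP k p]
    (e : ℕ) (he : 0 < e)
    (κ : k →+ k) (hκ : ToricFixed.IsFrobeniusSplitting (p ^ e) κ)
    (w : M) (φ : AddMonoid.End (AddMonoidAlgebra k (ToricFixed.latticePoints σ)))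
    (hφ : ToricFixed.IsToricMap (p ^ e) κ w φ)
    (𝔞 : Ideal (AddMonoidAlgebra k (ToricFixed.latticePoints σ)))
    (h𝔞 : ToricFixed.IsMonomialIdeal 𝔞)
    (t : ℚ) (ht : 0 ≤ t) (htp : ¬ p ∣ t.den)
    (𝓘 : Set (Ideal (AddMonoidAlgebra k (ToricFixed.latticePoints σ)))) (h𝓘 : 𝓘.Nonempty)
    (hfix : ∀ I ∈ 𝓘, ToricFixed.IsCartierFixed p e φ 𝔞 t I) :
    ToricFixed.IsCartierFixed p e φ 𝔞 t (sInf 𝓘) := by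
  have : Fact p.Prime := ⟨hp⟩
  have : IsAddTorsionFree M := .of_isTorsionFree ℤ M
  have hq : p ^ e ≠ 0 := pow_ne_zero _ hp.ne_zero
  obtain ⟨T, hT⟩ := hσ
  have hS : ∀ m, m ∈ latticePoints σ ↔
      ∃ K : ℕ, 0 < K ∧ ∃ c : M → ℕ, K • m = ∑ i ∈ T, c i • i := by
    rw [hT]
    exact mem_latticePoints_hull_iff T
  have hTS : ∀ m ∈ T, m ∈ latticePoints σ := by
    rw [hT]
    exact fun m hm => Submodule.subset_span ⟨m, hm, rfl⟩
  have hFG : AddMonoid.FG (latticePoints σ) :=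
    (AddMonoid.fg_iff_addSubmonoid_fg _).mpr (fg_of_saturation T _ hS)
  have hnoeth : IsNoetherianRing (AddMonoidAlgebra k (latticePoints σ)) :=
    Algebra.FiniteType.isNoetherianRing k _
  obtain ⟨A', rfl⟩ := h𝔞
  -- Farkas needs finitely many generators; Noetherianity selects them among the given monomials.
  obtain ⟨A, hA⟩ : ∃ A : Finset (latticePoints σ),
      Ideal.span ((fun s : latticePoints σ => AddMonoidAlgebra.single s (1 : k)) '' A') =
      Ideal.span ((fun s : latticePoints σ => AddMonoidAlgebra.single s (1 : k)) ''
        (A : Set (latticePoints σ))) := by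
    classical
    obtain ⟨B, hB, hB'⟩ :=
      (Submodule.fg_span_iff_fg_span_finset_subset _).mp (hnoeth.noetherian (Ideal.span
        ((fun s : latticePoints σ => AddMonoidAlgebra.single s (1 : k)) '' A')))
    obtain ⟨A, -, rfl⟩ := Finset.subset_set_image_iff.mp hB
    exact ⟨A, by simpa using hB'⟩
  rw [hA] at hfix ⊢
  refine le_antisymm (fun f hf => ?_) (fun f hf => ?_)
  · change f ∈ sInf 𝓘
    rw [Submodule.mem_sInf]
    intro I hI
    have h1 := cartierSum_mono (sInf_le hI) hf
    rw [show cartierSum p e φ _ t I = _ from hfix I hI] at h1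
    exact h1
  -- One member of the family suffices to bound the exponents of f; the extraction then multiplies f
  -- itself, which lies in the intersection.
  · obtain ⟨I, hI⟩ := h𝓘
    have hfI : f ∈ I := Submodule.mem_sInf.mp hf I hI
    rw [← AddMonoidAlgebra.sum_coeff_single f]
    refine sum_mem fun s hs => ?_
    have hs' := Finsupp.mem_support_iff.mp hs
    classical
    obtain ⟨B, hB⟩ := exists_forall_eq_smul_imp_eq_zero (Nat.one_lt_pow he.ne' hp.one_lt)
      (f.coeff.support.image fun z : latticePoints σ => (z : M) - (s : M))
    obtain ⟨n, N, hBn, hn, hN⟩ := exists_nat_eq_mul_pow_sub_one (e := e) hp ht htp B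
    obtain ⟨hu, hmem⟩ := single_mem_idealClosure_of_weight (k := k) T hS hTS A N
      (((p ^ e) ^ n • (s : M) + (∑ i ∈ Finset.range n, (p ^ e) ^ i) • w) - s) (by
        intro α μ hα hμ
        have hαS : ∀ m ∈ latticePoints σ, 0 ≤ α m := fun m hm =>
          nonneg_of_tmul_mem_hull T α hα (hT ▸ hm)
        have h1 := (hfix I hI).weight_nonneg he hφ
          (span_single_le_weightIdeal (hα := hαS) hμ) hfI hs'
        have hp1 : (1 : ℚ) < (p : ℚ) ^ e :=
          one_lt_pow₀ (by exact_mod_cast hp.one_lt) he.ne'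
        have hpn : (0 : ℚ) ≤ ((p : ℚ) ^ e) ^ n - 1 :=
          sub_nonneg.mpr (one_le_pow₀ hp1.le)
        -- Multiplying X(s) ≥ 0 by q^n-1 gives (q-1)(α(u) - Nμ) ≥ 0.
        have h2 := mul_nonneg hpn h1
        have h3 := congrArg (fun z => z * (α w : ℚ)) (geom_sum_mul ((p : ℚ) ^ e) n)
        rw [pow_mul] at hN
        have h4 : ((p : ℚ) ^ e - 1) * (N * μ) ≤ ((p : ℚ) ^ e - 1) * (((p : ℚ) ^ e) ^ n * α s +
            (∑ i ∈ Finset.range n, ((p : ℚ) ^ e) ^ i) * α w - α s) := by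
          rw [hN]
          linarith
        have h5 := le_of_mul_le_mul_left h4 (sub_pos.mpr hp1)
        have h6 : ((N * μ : ℤ) : ℚ) ≤ (α (((p ^ e) ^ n • (s : M) +
            (∑ i ∈ Finset.range n, (p ^ e) ^ i) • w) - s) : ℤ) := by
          simpa using h5
        exact_mod_cast h6)
    have hext := hφ.pow_single_mul_eq_single hq hκ (f := f) (s := s) (u := ⟨_, hu⟩)
      (sub_add_cancel _ _) (fun z hz d hd => hB n hBn _
        (Finset.mem_image_of_mem _ (Finsupp.mem_support_iff.mpr hz)) d hd)
    rw [← hext]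
    refine AddSubgroup.mem_iSup_of_mem n (AddSubgroup.mem_iSup_of_mem N
      (AddSubgroup.mem_iSup_of_mem ⟨hn, hN⟩ (AddSubgroup.mem_map_of_mem _ ?_)))
    refine Ideal.mul_mem_mul ?_ hf
    have := Ideal.mul_mem_left _ (AddMonoidAlgebra.single 0 (f.coeff s ^ ((p ^ e) ^ n - 1))) hmem
    rwa [AddMonoidAlgebra.single_mul_single, zero_add, mul_one] at this
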